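/- All matroids have finite ground sets. For a matroid $M$ on $S$, with rank function $\rho_M$, and $A\subseteq S$, put $\lambda_M(A)=\rho_M(S)-\rho_M(A)$ and $\nu_M(A)=|A|-\rho_M(A)$. The *free product* $M\mathbin{\Box}N$ of matroids $M$ on $S$ and $N$ on $T$ is the matroid on the disjoint union $S+T$ whose independent sets are the sets $A\subseteq S+T$ such that $A\cap S$ is independent in $M$ and $\lambda_M(A\cap S)\ge\nu_N(A\cap T)$. The free product of the empty sequence of matroids is the empty matroid. A matroid $M$ with nonempty ground set is *irreducible* if in every factorization of $M$, up to isomorphism, as a free product of finitely many matroids some factor is isomorphic to $M$; the empty matroid is not irreducible. **Theorem (unique factorization).** If a matroid $M$ satisfies $M\cong M_1\mathbin{\Box}\cdots\mathbin{\Box}M_k\cong N_1\mathbin{\Box}\cdots\mathbin{\Box}N_r$ with $k,r\ge 0$ and all $M_i$ and $N_j$ irreducible, then $k=r$ and $M_i\cong N_i$ for $1\le i\le k$. Moreover, the set of isomorphism classes of matroids, with the binary operation induced by free product, is a free monoid with the class of the empty matroid as identity, freely generated by the isomorphism classes of irreducible matroids (in particular, every matroid is isomorphic to a free product of irreducible matroids).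 -/

import Mathlib

open Set

universe u v w

namespace FreeProd

variable {α : Type u} {β : Type v} {γ : Type w}

/-- The rank `ρ_M(X)`, as a natural number. It is only used for matroids on finite ground sets,
where no truncation occurs. -/
noncomputable def rk (M : Matroid α) (X : Set α) : ℕ := (M.eRk X).toNat

/-- The rank-lack `λ_M(X) = ρ(M) - ρ_M(X)`. -/
noncomputable def rankLack (M : Matroid α) (X : Set α) : ℤ := (rk M M.E : ℤ) - (rk M X : ℤ)

/-- The nullity `ν_M(X) = |X| - ρ_M(X)`. -/
noncomputable def nullity (M : Matroid α) (X : Set α) : ℤ := (X.ncard : ℤ) - (rk M X : ℤ)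

theorem coe_rk (M : Matroid α) [M.Finite] (X : Set α) : (rk M X : ℕ∞) = M.eRk X :=
  ENat.natCast_toNat (by simp)

theorem rk_indep {M : Matroid α} {I : Set α} (h : M.Indep I) : rk M I = I.ncard := by
  rw [rk, h.eRk_eq_encard]; rfl

theorem rk_mono (M : Matroid α) [M.Finite] {X Y : Set α} (h : X ⊆ Y) : rk M X ≤ rk M Y := by
  have := M.eRk_mono h
  rw [← coe_rk, ← coe_rk] at this
  exact_mod_cast this

theorem rk_le_add (M : Matroid α) [M.Finite] {X Y : Set α} (h : X ⊆ Y) (hY : Y.Finite) :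
    rk M Y + X.ncard ≤ rk M X + Y.ncard := by
  have h1 := M.eRk_le_eRk_add_eRk_sdiff h
  have h2 := M.eRk_le_encard (Y \ X)
  rw [← (hY.subset sdiff_subset).cast_ncard_eq, ← coe_rk] at h2
  rw [← coe_rk, ← coe_rk, ← coe_rk] at h1
  have h3 := ncard_sdiff_add_ncard_of_subset h hY
  norm_cast at h1 h2
  omega

theorem ncard_sum {A : Set (α ⊕ β)} (hA : A.Finite) :
    A.ncard = (Sum.inl ⁻¹' A).ncard + (Sum.inr ⁻¹' A).ncard := by
  have h : A = Sum.inl '' (Sum.inl ⁻¹' A) ∪ Sum.inr '' (Sum.inr ⁻¹' A) := by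
    ext x; cases x <;> simp
  have h1 : (Sum.inl ⁻¹' A).Finite := hA.preimage Sum.inl_injective.injOn
  have h2 : (Sum.inr ⁻¹' A).Finite := hA.preimage Sum.inr_injective.injOn
  conv_lhs => rw [h]
  rw [ncard_union_eq _ (h1.image _) (h2.image _), ncard_image_of_injective _ Sum.inl_injective,
    ncard_image_of_injective _ Sum.inr_injective]
  rw [Set.disjoint_left]
  rintro _ ⟨a, -, rfl⟩ ⟨b, -, h⟩
  cases h

/-- The ground set of the free product: the disjoint union of the two ground sets. -/
def ground (M : Matroid α) (N : Matroid β) : Set (α ⊕ β) := Sum.inl '' M.E ∪ Sum.inr '' N.E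

@[simp] theorem inl_mem_ground {M : Matroid α} {N : Matroid β} {a : α} :
    Sum.inl a ∈ ground M N ↔ a ∈ M.E := by simp [ground]

@[simp] theorem inr_mem_ground {M : Matroid α} {N : Matroid β} {b : β} :
    Sum.inr b ∈ ground M N ↔ b ∈ N.E := by simp [ground]

theorem ground_finite (M : Matroid α) (N : Matroid β) [M.Finite] [N.Finite] :
    (ground M N).Finite :=
  (M.ground_finite.image _).union (N.ground_finite.image _)

/-- Independence in the free product of `M` on `S` and `N` on `T`: a subset `A` of `S + T` is
independent if `A ∩ S` is independent in `M` and `λ_M(A ∩ S) ≥ ν_N(A ∩ T)`. -/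
def Indep (M : Matroid α) (N : Matroid β) (A : Set (α ⊕ β)) : Prop :=
  A ⊆ ground M N ∧ M.Indep (Sum.inl ⁻¹' A) ∧
    nullity N (Sum.inr ⁻¹' A) ≤ rankLack M (Sum.inl ⁻¹' A)

theorem indep_iff {M : Matroid α} {N : Matroid β} [M.Finite] [N.Finite] {A : Set (α ⊕ β)} :
    Indep M N A ↔ A ⊆ ground M N ∧ M.Indep (Sum.inl ⁻¹' A) ∧
      A.ncard ≤ rk M M.E + rk N (Sum.inr ⁻¹' A) := by
  refine and_congr_right fun hA => and_congr_right fun hi => ?_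
  rw [ncard_sum ((ground_finite M N).subset hA), nullity, rankLack, rk_indep hi]
  omega

/-- The free product of two matroids with finite ground sets. -/
noncomputable def freeProduct (M : Matroid α) (N : Matroid β) [M.Finite] [N.Finite] :
    Matroid (α ⊕ β) :=
  (IndepMatroid.ofFinite (ground_finite M N) (Indep M N)
    (by rw [indep_iff]; simp)
    (by
      intro I J hJ hIJ
      rw [indep_iff] at hJ ⊢
      obtain ⟨h1, h2, h3⟩ := hJ
      have hJf := (ground_finite M N).subset h1
      refine ⟨hIJ.trans h1, h2.subset (preimage_mono hIJ), ?_⟩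
      have h4 := rk_le_add N (preimage_mono (f := Sum.inr) hIJ)
        (hJf.preimage Sum.inr_injective.injOn)
      have h5 : (Sum.inl ⁻¹' I).ncard ≤ (Sum.inl ⁻¹' J).ncard :=
        ncard_le_ncard (preimage_mono hIJ) (hJf.preimage Sum.inl_injective.injOn)
      rw [ncard_sum hJf] at h3
      rw [ncard_sum (hJf.subset hIJ)]
      omega)
    (by
      intro I J hI hJ hlt
      rw [indep_iff] at hI hJ
      obtain ⟨hI1, hI2, hI3⟩ := hI
      obtain ⟨hJ1, hJ2, hJ3⟩ := hJ
      have hIf := (ground_finite M N).subset hI1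
      have hJf := (ground_finite M N).subset hJ1
      have key_l (a : α) : (Sum.inl ⁻¹' (insert (Sum.inl a) I : Set (α ⊕ β)))
          = insert a (Sum.inl ⁻¹' I) := by ext; simp
      have key_l' (a : α) : (Sum.inr ⁻¹' (insert (Sum.inl a) I : Set (α ⊕ β)))
          = (Sum.inr ⁻¹' I) := by ext; simp
      have key_r (b : β) : (Sum.inr ⁻¹' (insert (Sum.inr b) I : Set (α ⊕ β)))
          = insert b (Sum.inr ⁻¹' I) := by ext; simp
      have key_r' (b : β) : (Sum.inl ⁻¹' (insert (Sum.inr b) I : Set (α ⊕ β)))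
          = (Sum.inl ⁻¹' I) := by ext; simp
      rcases hI3.lt_or_eq with hI3 | hI3
      · by_cases hl : (Sum.inl ⁻¹' I).ncard < (Sum.inl ⁻¹' J).ncard
        · have hl' : (Sum.inl ⁻¹' I).encard < (Sum.inl ⁻¹' J).encard := by
            rw [← (hIf.preimage Sum.inl_injective.injOn).cast_ncard_eq,
              ← (hJf.preimage Sum.inl_injective.injOn).cast_ncard_eq]
            exact_mod_cast hl
          obtain ⟨a, ⟨ha, ha'⟩, hai⟩ := hI2.augment hJ2 hl'
          refine ⟨Sum.inl a, ha, ha', ?_⟩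
          rw [indep_iff, key_l, key_l', ncard_insert_of_notMem (s := I) (a := Sum.inl a) ha' hIf]
          exact ⟨insert_subset (hJ1 ha) hI1, hai, by omega⟩
        · have hr : (Sum.inr ⁻¹' I).ncard < (Sum.inr ⁻¹' J).ncard := by
            rw [ncard_sum hIf, ncard_sum hJf] at hlt
            omega
          obtain ⟨b, hb, hb'⟩ := exists_mem_notMem_of_ncard_lt_ncard hr
            (hIf.preimage Sum.inr_injective.injOn)
          refine ⟨Sum.inr b, hb, hb', ?_⟩
          rw [indep_iff, key_r, key_r', ncard_insert_of_notMem (s := I) (a := Sum.inr b) hb' hIf]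
          have := rk_mono N (subset_insert b (Sum.inr ⁻¹' I))
          exact ⟨insert_subset (hJ1 hb) hI1, hI2, by omega⟩
      · have hr : N.eRk (Sum.inr ⁻¹' I) < N.eRk (Sum.inr ⁻¹' J) := by
          rw [← coe_rk, ← coe_rk]
          norm_cast
          omega
        obtain ⟨b, ⟨hb, hb'⟩, hbr⟩ := Matroid.exists_eRk_insert_eq_add_one_of_lt hr
        rw [← coe_rk, ← coe_rk] at hbr
        norm_cast at hbr
        refine ⟨Sum.inr b, hb, hb', ?_⟩
        rw [indep_iff, key_r, key_r', ncard_insert_of_notMem (s := I) (a := Sum.inr b) hb' hIf]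
        exact ⟨insert_subset (hJ1 hb) hI1, hI2, by omega⟩)
    (fun _ h => h.1)).matroid

theorem freeProduct_E (M : Matroid α) (N : Matroid β) [M.Finite] [N.Finite] :
    (freeProduct M N).E = ground M N := rfl

theorem freeProduct_indep (M : Matroid α) (N : Matroid β) [M.Finite] [N.Finite]
    (A : Set (α ⊕ β)) : (freeProduct M N).Indep A ↔ Indep M N A := Iff.rfl

instance freeProduct_finite (M : Matroid α) (N : Matroid β) [M.Finite] [N.Finite] :
    (freeProduct M N).Finite := ⟨ground_finite M N⟩

/-- Two matroids are isomorphic if there is a bijection between their ground sets under which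
independent sets correspond. -/
def IsIso (M : Matroid α) (N : Matroid β) : Prop :=
  ∃ e : M.E ≃ N.E, ∀ I : Set M.E,
    M.Indep (Subtype.val '' I) ↔ N.Indep (Subtype.val '' (e '' I))

theorem IsIso.refl (M : Matroid α) : IsIso M M := ⟨Equiv.refl _, fun I => by simp⟩

theorem IsIso.symm {M : Matroid α} {N : Matroid β} (h : IsIso M N) : IsIso N M := by
  obtain ⟨e, he⟩ := h
  refine ⟨e.symm, fun I => ?_⟩
  rw [he, ← image_comp e e.symm]
  simp

theorem IsIso.trans {M : Matroid α} {N : Matroid β} {P : Matroid γ} (h : IsIso M N)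
    (h' : IsIso N P) : IsIso M P := by
  obtain ⟨e, he⟩ := h
  obtain ⟨f, hf⟩ := h'
  refine ⟨e.trans f, fun I => ?_⟩
  rw [he, hf, ← image_comp f e]
  rfl

theorem ncard_equiv {M : Matroid α} {N : Matroid β} (e : M.E ≃ N.E) (I : Set M.E) :
    ((Subtype.val '' (e '' I)) : Set β).encard = ((Subtype.val '' I) : Set α).encard := by
  rw [Subtype.val_injective.encard_image, e.injective.encard_image,
    Subtype.val_injective.encard_image]

theorem eRk_le_of_equiv {M : Matroid α} {N : Matroid β} (e : M.E ≃ N.E)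
    (he : ∀ I : Set M.E, M.Indep (Subtype.val '' I) ↔ N.Indep (Subtype.val '' (e '' I)))
    (X : Set M.E) : M.eRk (Subtype.val '' X) ≤ N.eRk (Subtype.val '' (e '' X)) := by
  rw [Matroid.eRk_le_iff]
  intro I hIX hI
  obtain ⟨I, hI', rfl⟩ := subset_image_iff.1 hIX
  rw [← ncard_equiv e I]
  exact ((he I).1 hI).encard_le_eRk_of_subset (image_mono (image_mono hI'))

theorem rk_equiv {M : Matroid α} {N : Matroid β} (e : M.E ≃ N.E)
    (he : ∀ I : Set M.E, M.Indep (Subtype.val '' I) ↔ N.Indep (Subtype.val '' (e '' I)))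
    (X : Set M.E) : rk N (Subtype.val '' (e '' X)) = rk M (Subtype.val '' X) := by
  refine congrArg ENat.toNat (le_antisymm ?_ (eRk_le_of_equiv e he X))
  refine (eRk_le_of_equiv e.symm (fun I => ?_) (e '' X)).trans (le_of_eq ?_)
  · rw [he, ← image_comp e e.symm]
    simp
  · rw [← image_comp e.symm e]
    simp

theorem rk_ground_equiv {M : Matroid α} {N : Matroid β} (e : M.E ≃ N.E)
    (he : ∀ I : Set M.E, M.Indep (Subtype.val '' I) ↔ N.Indep (Subtype.val '' (e '' I))) :
    rk N N.E = rk M M.E := by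
  simpa using rk_equiv e he univ

/-- Free product respects isomorphism, so that it descends to isomorphism classes. -/
theorem IsIso.freeProduct {α' : Type*} {β' : Type*} {M : Matroid α} {N : Matroid β}
    {M' : Matroid α'} {N' : Matroid β'} [M.Finite] [N.Finite] [M'.Finite] [N'.Finite]
    (hM : IsIso M M') (hN : IsIso N N') : IsIso (freeProduct M N) (freeProduct M' N') := by
  obtain ⟨e, he⟩ := hM
  obtain ⟨f, hf⟩ := hN
  let g : ground M N ≃ ground M' N' :=
    { toFun := fun x => match x with
        | ⟨.inl a, h⟩ => ⟨.inl (e ⟨a, inl_mem_ground.1 h⟩), inl_mem_ground.2 (Subtype.prop _)⟩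
        | ⟨.inr b, h⟩ => ⟨.inr (f ⟨b, inr_mem_ground.1 h⟩), inr_mem_ground.2 (Subtype.prop _)⟩
      invFun := fun x => match x with
        | ⟨.inl a, h⟩ => ⟨.inl (e.symm ⟨a, inl_mem_ground.1 h⟩), inl_mem_ground.2 (Subtype.prop _)⟩
        | ⟨.inr b, h⟩ => ⟨.inr (f.symm ⟨b, inr_mem_ground.1 h⟩), inr_mem_ground.2 (Subtype.prop _)⟩
      left_inv := by rintro ⟨a | b, h⟩ <;> simp
      right_inv := by rintro ⟨a | b, h⟩ <;> simp }
  suffices h : ∀ I : Set (ground M N), Indep M N (Subtype.val '' I) ↔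
      Indep M' N' (Subtype.val '' (g '' I)) from ⟨g, h⟩
  intro I
  let I₁ : Set M.E := {a | ⟨.inl a.1, inl_mem_ground.2 a.2⟩ ∈ I}
  let I₂ : Set N.E := {b | ⟨.inr b.1, inr_mem_ground.2 b.2⟩ ∈ I}
  have h1 : Sum.inl ⁻¹' (Subtype.val '' I : Set (α ⊕ β)) = Subtype.val '' I₁ := by
    ext a
    constructor
    · rintro ⟨⟨x, hx⟩, hxI, rfl⟩
      exact ⟨⟨a, inl_mem_ground.1 hx⟩, hxI, rfl⟩
    · rintro ⟨x, hx, rfl⟩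
      exact ⟨_, hx, rfl⟩
  have h2 : Sum.inr ⁻¹' (Subtype.val '' I : Set (α ⊕ β)) = Subtype.val '' I₂ := by
    ext a
    constructor
    · rintro ⟨⟨x, hx⟩, hxI, rfl⟩
      exact ⟨⟨a, inr_mem_ground.1 hx⟩, hxI, rfl⟩
    · rintro ⟨x, hx, rfl⟩
      exact ⟨_, hx, rfl⟩
  have h3 : Sum.inl ⁻¹' (Subtype.val '' (g '' I) : Set (α' ⊕ β')) = Subtype.val '' (e '' I₁) := by
    ext a
    constructor
    · rintro ⟨_, ⟨⟨x | x, hx⟩, hxI, rfl⟩, h⟩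
      · exact ⟨_, ⟨⟨x, inl_mem_ground.1 hx⟩, hxI, rfl⟩, Sum.inl_injective h⟩
      · cases h
    · rintro ⟨_, ⟨x, hx, rfl⟩, rfl⟩
      exact ⟨_, ⟨_, hx, rfl⟩, rfl⟩
  have h4 : Sum.inr ⁻¹' (Subtype.val '' (g '' I) : Set (α' ⊕ β')) = Subtype.val '' (f '' I₂) := by
    ext a
    constructor
    · rintro ⟨_, ⟨⟨x | x, hx⟩, hxI, rfl⟩, h⟩
      · cases h
      · exact ⟨_, ⟨⟨x, inr_mem_ground.1 hx⟩, hxI, rfl⟩, Sum.inr_injective h⟩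
    · rintro ⟨_, ⟨x, hx, rfl⟩, rfl⟩
      exact ⟨_, ⟨_, hx, rfl⟩, rfl⟩
  have h5 : (Subtype.val '' I : Set (α ⊕ β)) ⊆ ground M N := by
    rintro _ ⟨x, -, rfl⟩; exact x.2
  have h6 : (Subtype.val '' (g '' I) : Set (α' ⊕ β')) ⊆ ground M' N' := by
    rintro _ ⟨x, -, rfl⟩; exact x.2
  have h7 : (Subtype.val '' (f '' I₂) : Set β').ncard = (Subtype.val '' I₂ : Set β).ncard :=
    congrArg ENat.toNat (ncard_equiv f I₂)
  refine (and_iff_right h5).trans (Iff.trans ?_ (and_iff_right h6).symm)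
  rw [h1, h2, h3, h4, nullity, nullity, rankLack, rankLack, rk_equiv e he, rk_equiv f hf,
    rk_ground_equiv e he, h7, he I₁]

end FreeProd

/-- A matroid with finite ground set, bundled with the type its ground set lives in. -/
structure FinMatroid : Type (u + 1) where
  carrier : Type u
  matroid : Matroid carrier
  finite : matroid.Finite

namespace FinMatroid

instance (M : FinMatroid.{u}) : M.matroid.Finite := M.finite

/-- Isomorphism of matroids. -/
def Iso (M N : FinMatroid.{u}) : Prop := FreeProd.IsIso M.matroid N.matroid

/-- The empty matroid. -/
def empty : FinMatroid.{u} := ⟨PEmpty.{u + 1}, Matroid.emptyOn _, inferInstance⟩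

/-- The free product of two matroids. -/
noncomputable def freeProduct (M N : FinMatroid.{u}) : FinMatroid.{u} :=
  ⟨M.carrier ⊕ N.carrier, FreeProd.freeProduct M.matroid N.matroid, inferInstance⟩

/-- The iterated free product of a finite sequence of matroids; the product of the empty
sequence is the empty matroid. -/
noncomputable def freeProductList : List FinMatroid.{u} → FinMatroid.{u}
  | [] => empty
  | M :: L => M.freeProduct (freeProductList L)

/-- A nonempty matroid is irreducible if any factorization of it as a free product of matroids
contains the matroid itself as a factor. The empty matroid is not irreducible. -/
def Irreducible (M : FinMatroid.{u}) : Prop :=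
  M.matroid.E.Nonempty ∧
    ∀ L : List FinMatroid.{u}, M.Iso (freeProductList L) → ∃ P ∈ L, P.Iso M

/-- Isomorphism, as an equivalence relation. -/
instance isoSetoid : Setoid FinMatroid.{u} where
  r := Iso
  iseqv := ⟨fun M => FreeProd.IsIso.refl M.matroid, fun h => FreeProd.IsIso.symm h,
    fun h h' => FreeProd.IsIso.trans h h'⟩

end FinMatroid

/-- Isomorphism classes of matroids with finite ground set. -/
def MatroidClass : Type (u + 1) := Quotient FinMatroid.isoSetoid.{u}

namespace MatroidClass

/-- The isomorphism class of a matroid. -/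
def mk (M : FinMatroid.{u}) : MatroidClass.{u} := Quotient.mk _ M

/-- The operation on isomorphism classes that is induced by free product. -/
noncomputable instance : Mul MatroidClass.{u} where
  mul := Quotient.map₂ FinMatroid.freeProduct
    fun _ _ h _ _ h' => FreeProd.IsIso.freeProduct h h'

/-- The class of the empty matroid. -/
instance : One MatroidClass.{u} where
  one := mk FinMatroid.empty

theorem mk_mul_mk (M N : FinMatroid.{u}) : mk M * mk N = mk (M.freeProduct N) := rfl

/-- The isomorphism classes of irreducible matroids. -/
def irreducibles : Set MatroidClass.{u} := {c | ∃ M : FinMatroid.{u}, M.Irreducible ∧ mk M = c}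

end MatroidClass

/-!
The argument rests on the notion of a free separator of a matroid `M`: a set `A` of elements such
that every circuit of `M` either lies in `A` or spans `A`. The free separators are exactly the sets
along which `M` splits as a free product. If `A` is one, then `M` is isomorphic to the free product
of `M ↾ A` and `M ／ A` (`IsFreeSeparator.isIso`); conversely the ground set of the left factor of
a free product is a free separator, and the two factors are recovered from it by restriction and
contraction (`isFreeSeparator_freeProduct`, `freeProduct_restrict_left`,
`freeProduct_contract_left`). The link is `isFreeSeparator_iff_rk`, which rewrites the condition on
circuits as the independence condition of the free product. Consequently the irreducible matroids
are the nonempty ones whose only free separators are the empty set and the ground set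
(`FinMatroid.irreducible_iff`), and by induction on the number of elements every matroid is a free
product of irreducible ones. Associativity, which makes the isomorphism classes a monoid, follows
from the rank formula `rk_freeProduct`.

Uniqueness reduces to cancelling an irreducible left factor. Let `A` and `A'` be nonempty free
separators of `M` such that `M ↾ A` and `M ↾ A'` have only trivial free separators. The
intersection `A ∩ A'` is again a free separator, so either `A = A'` or `A` and `A'` are disjoint.
In the disjoint case every circuit of `M` spans both `A` and `A'`
(`subset_closure_of_disjoint`). Then all subsets of `A` and of `A'` are free separators, whence
`A = {a}` and `A' = {b}`, and exchanging `a` with `b` is an automorphism of `M`. In both cases an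
automorphism of `M` carries `A` to `A'` (`exists_automorphism`), so the restrictions to `A` and
`A'` are isomorphic and so are the contractions.
-/

namespace FreeProd

open scoped Matroid

variable {α : Type u} {β : Type v} {γ : Type w}

/-! ### Ranks in restrictions and contractions -/

theorem indep_iff_rk (M : Matroid α) [M.Finite] {I : Set α} (hI : I ⊆ M.E) :
    M.Indep I ↔ I.ncard ≤ rk M I := by
  refine ⟨fun h => (rk_indep h).ge, fun h => ?_⟩
  have hfin := M.ground_finite.subset hI
  refine (Matroid.RankFinite.isRkFinite I).indep_of_encard_le_eRk ?_
  rw [← coe_rk, ← hfin.cast_ncard_eq]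
  exact_mod_cast h

theorem rk_le_ncard (M : Matroid α) [M.Finite] {X : Set α} (hX : X.Finite) :
    rk M X ≤ X.ncard := by
  have h := M.eRk_le_encard X
  rw [← coe_rk, ← hX.cast_ncard_eq] at h
  exact_mod_cast h

theorem rk_restrict (M : Matroid α) {R X : Set α} (h : X ⊆ R) : rk (M ↾ R) X = rk M X := by
  rw [rk, rk, M.restrict_eRk_eq h]

theorem rk_map {f : α → β} (M : Matroid α) (hf : InjOn f M.E) {X : Set α} (hX : X ⊆ M.E) :
    rk (M.map f hf) (f '' X) = rk M X := by
  rw [rk, rk, M.eRk_map hf hX]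

/-- Independence in a contraction, in terms of the rank function. -/
theorem contract_indep_iff_rk (M : Matroid α) [M.Finite] {A J : Set α} (hA : A ⊆ M.E) :
    (M ／ A).Indep J ↔ J ⊆ M.E \ A ∧ rk M A + J.ncard ≤ rk M (A ∪ J) := by
  obtain ⟨I, hI⟩ := M.exists_isBasis A
  have hr : rk M (A ∪ J) = rk M (J ∪ I) := by
    rw [union_comm J I, rk, rk, hI.eRk_eq_eRk_union]
  rw [hI.contract_indep_iff, subset_sdiff, hr]
  constructor
  · rintro ⟨h, hd⟩
    have hJ : J ⊆ M.E := subset_union_left.trans h.subset_ground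
    refine ⟨⟨hJ, hd.symm⟩, ?_⟩
    rw [rk_indep h, ncard_union_eq (hd.symm.mono_right hI.subset)
      (M.ground_finite.subset hJ) (M.ground_finite.subset hI.indep.subset_ground),
      ← rk_indep hI.indep, add_comm, rk, rk, hI.eRk_eq_eRk]
  · rintro ⟨⟨hJ, hd⟩, h⟩
    refine ⟨?_, hd.symm⟩
    rw [indep_iff_rk M (union_subset hJ hI.indep.subset_ground)]
    rw [ncard_union_eq (hd.mono_right hI.subset)
      (M.ground_finite.subset hJ) (M.ground_finite.subset hI.indep.subset_ground),
      ← rk_indep hI.indep, add_comm, rk, hI.eRk_eq_eRk]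
    exact h

theorem rk_contract (M : Matroid α) [M.Finite] {A J : Set α} (hA : A ⊆ M.E) (hJ : J ⊆ M.E \ A) :
    rk M A + rk (M ／ A) J = rk M (A ∪ J) := by
  have hfin : J.Finite := M.ground_finite.subset (hJ.trans sdiff_subset)
  obtain ⟨K, hK⟩ := (M ／ A).exists_isBasis J
  obtain ⟨I, hI⟩ := M.exists_isBasis A
  have hKd := (contract_indep_iff_rk M hA).1 hK.indep
  have hr : rk (M ／ A) J = K.ncard := by rw [← rk_indep hK.indep, rk, rk, hK.eRk_eq_eRk]
  refine le_antisymm (hr ▸ hKd.2.trans (rk_mono M (union_subset_union_right _ hK.subset))) ?_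
  -- extend a basis of `A` to a basis of `A ∪ J`; the new elements are independent in `M ／ A`
  obtain ⟨L, hL, hIL⟩ := hI.indep.subset_isBasis_of_subset
    (hI.subset.trans (subset_union_left (t := J))) (union_subset hA (hJ.trans sdiff_subset))
  have hLI : (M ／ A).Indep (L \ A) := by
    rw [hI.contract_indep_iff]
    refine ⟨hL.indep.subset (union_subset sdiff_subset hIL), disjoint_sdiff_right⟩
  have hLA : L \ A ⊆ J := fun x hx => (hL.subset hx.1).resolve_left hx.2
  have h1 : rk M (A ∪ J) = L.ncard := by rw [← rk_indep hL.indep, rk, rk, hL.eRk_eq_eRk]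
  have hLf : L.Finite := M.ground_finite.subset hL.indep.subset_ground
  have h2 : (L ∩ A).ncard ≤ rk M A := by
    rw [← rk_indep (hL.indep.subset inter_subset_left)]
    exact rk_mono M inter_subset_right
  have h3 : (L \ A).ncard ≤ rk (M ／ A) J := by
    rw [← rk_indep hLI]
    exact rk_mono _ hLA
  have h4 := ncard_inter_add_ncard_sdiff_eq_ncard L A hLf
  omega

/-! ### Free separators -/

/-- A set `A` of elements of `M` is a free separator if every circuit of `M` either lies in `A`
or spans `A`. -/
def IsFreeSeparator (M : Matroid α) (A : Set α) : Prop :=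
  A ⊆ M.E ∧ ∀ C, M.IsCircuit C → C ⊆ A ∨ A ⊆ M.closure C

theorem subset_closure_of_rk_le (M : Matroid α) [M.Finite] {A X : Set α} (hA : A ⊆ M.E)
    (hX : X ⊆ M.E) (h : rk M (A ∪ X) ≤ rk M X) : A ⊆ M.closure X := by
  have h1 : M.eRk (A ∪ X) ≤ M.eRk X := by
    rw [← coe_rk, ← coe_rk]
    exact_mod_cast h
  rw [(Matroid.RankFinite.isRkFinite X).closure_eq_closure_of_subset_of_eRk_ge_eRk
    subset_union_right h1]
  exact subset_union_left.trans (M.subset_closure _ (union_subset hA hX))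

/-- `A` is a free separator exactly when independence of `I` is decided by `I ∩ A` and by the rank
of `A ∪ I` in the way prescribed by the free product of `M ↾ A` and `M ／ A`. -/
theorem isFreeSeparator_iff_rk (M : Matroid α) [M.Finite] {A : Set α} :
    IsFreeSeparator M A ↔ A ⊆ M.E ∧
      ∀ I ⊆ M.E, M.Indep (I ∩ A) → I.ncard ≤ rk M (A ∪ I) → M.Indep I := by
  refine and_congr_right fun hA => ⟨fun h I hI hIA hr => ?_, fun h C hC => ?_⟩
  · by_contra hdep
    obtain ⟨C, hCI, hC⟩ := ((Matroid.not_indep_iff hI).1 hdep).exists_isCircuit_subset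
    rcases h C hC with h | h
    · exact hC.not_indep (hIA.subset (subset_inter hCI h))
    · have h1 : M.closure (A ∪ I) = M.closure I := by
        refine (M.closure_subset_closure_of_subset_closure (union_subset
          (h.trans (M.closure_subset_closure hCI)) (M.subset_closure I hI))).antisymm
            (M.closure_subset_closure subset_union_right)
      rw [rk, ← M.eRk_closure_eq, h1, M.eRk_closure_eq] at hr
      exact hdep ((indep_iff_rk M hI).2 hr)
  · by_contra! hcon
    obtain ⟨h1, h2⟩ := hcon
    have hCE := hC.subset_ground
    have hCA : M.Indep (C ∩ A) := hC.ssubset_indep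
      ⟨inter_subset_left, fun h => h1 (h.trans inter_subset_right)⟩
    refine h2 (subset_closure_of_rk_le M hA hCE ?_)
    by_contra! hlt
    have h3 := hC.eRk_add_one_eq
    rw [← coe_rk, ← (M.ground_finite.subset hCE).cast_ncard_eq] at h3
    norm_cast at h3
    exact hC.not_indep (h C hCE hCA (by omega))

theorem isFreeSeparator_map_iff {M : Matroid α} [M.Finite] {f : α → β} (hf : f.Injective)
    {A : Set α} (hA : A ⊆ M.E) :
    IsFreeSeparator (M.map f hf.injOn) (f '' A) ↔ IsFreeSeparator M A := by
  have hind : ∀ I, M.Indep I ↔ (M.map f hf.injOn).Indep (f '' I) := fun I => by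
    refine ⟨fun h => h.map f hf.injOn, fun h => ?_⟩
    obtain ⟨J, hJ, h⟩ := Matroid.map_indep_iff.1 h
    rwa [hf.image_injective h]
  have hrk : ∀ I ⊆ M.E, rk (M.map f hf.injOn) (f '' A ∪ f '' I) = rk M (A ∪ I) := fun I hI => by
    rw [← image_union, rk_map M _ (union_subset hA hI)]
  rw [isFreeSeparator_iff_rk, isFreeSeparator_iff_rk, and_iff_right hA,
    and_iff_right (show f '' A ⊆ (M.map f hf.injOn).E from image_mono hA)]
  constructor
  · intro h I hI hIA hr
    rw [hind]
    refine h _ (image_mono hI) ?_ ?_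
    · rwa [← image_inter hf, ← hind]
    · rwa [hrk I hI, ncard_image_of_injective _ hf]
  · intro h J hJ hJA hr
    obtain ⟨I, hI, rfl⟩ := subset_image_iff.1 hJ
    rw [hrk I hI, ncard_image_of_injective _ hf] at hr
    rw [← image_inter hf, ← hind] at hJA
    exact (hind I).1 (h I hI hJA hr)

theorem IsFreeSeparator.inter {M : Matroid α} {A A' : Set α} (h : IsFreeSeparator M A)
    (h' : IsFreeSeparator M A') : IsFreeSeparator M (A ∩ A') := by
  refine ⟨inter_subset_left.trans h.1, fun C hC => ?_⟩
  rcases h.2 C hC with h1 | h1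
  · rcases h'.2 C hC with h2 | h2
    · exact .inl (subset_inter h1 h2)
    · exact .inr (inter_subset_right.trans h2)
  · exact .inr (inter_subset_left.trans h1)

theorem IsFreeSeparator.restrict {M : Matroid α} {A R : Set α} (h : IsFreeSeparator M A)
    (hAR : A ⊆ R) (hR : R ⊆ M.E) : IsFreeSeparator (M ↾ R) A := by
  refine ⟨hAR, fun C hC => ?_⟩
  rw [Matroid.restrict_isCircuit_iff hR] at hC
  rcases h.2 C hC.1 with h1 | h1
  · exact .inl h1
  · right
    rw [M.restrict_closure_eq hC.2 hR]
    exact subset_inter h1 hAR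

/-! ### Two free separators -/

/-- `M` has no free separators other than the empty set and the whole ground set. The empty
matroid satisfies this as well. -/
def IsFreelyConnected (M : Matroid α) : Prop :=
  ∀ A, IsFreeSeparator M A → A = ∅ ∨ A = M.E

/-- If `A` and `A'` are disjoint free separators, every circuit spans `A`. For a circuit `C`
contained in `A`, this uses a circuit `C' ⊆ C ∪ {a'}` through an element `a'` of `A'`. -/
theorem subset_closure_of_disjoint {M : Matroid α} {A A' : Set α} (h : IsFreeSeparator M A)
    (h' : IsFreeSeparator M A') (hd : Disjoint A A') (hne' : A'.Nonempty)
    {C : Set α} (hC : M.IsCircuit C) : A ⊆ M.closure C := by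
  rcases h.2 C hC with h1 | h1
  · obtain ⟨a', ha'⟩ := hne'
    have h2 : A' ⊆ M.closure C := by
      refine (h'.2 C hC).resolve_left fun h2 => ?_
      obtain ⟨c, hc⟩ := hC.nonempty
      exact disjoint_left.1 hd (h1 hc) (h2 hc)
    have haC : a' ∉ C := fun hc => disjoint_left.1 hd (h1 hc) ha'
    obtain ⟨C', hC'C, hC', haC'⟩ := Matroid.exists_isCircuit_of_mem_closure (h2 ha') haC
    have h3 : A ⊆ M.closure C' :=
      (h.2 C' hC').resolve_left fun h3 => disjoint_left.1 hd (h3 haC') ha'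
    exact h3.trans (M.closure_subset_closure_of_subset_closure
      (hC'C.trans (insert_subset (h2 ha') (M.subset_closure C hC.subset_ground))))
  · exact h1

/-- If every circuit spans both `a` and `b`, then exchanging `a` for `b` in an independent set
gives an independent set. -/
theorem indep_exchange {M : Matroid α} {a b : α} (hb : b ∈ M.E)
    (hspan : ∀ C, M.IsCircuit C → a ∈ M.closure C) {I : Set α} (hI : M.Indep I)
    (haI : a ∈ I) : M.Indep (insert b (I \ {a})) := by
  by_contra hdep
  obtain ⟨C, hCI, hC⟩ := ((Matroid.not_indep_iff
    (insert_subset hb (sdiff_subset.trans hI.subset_ground))).1 hdep).exists_isCircuit_subset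
  refine hI.notMem_closure_sdiff_of_mem haI ?_
  have h1 := hspan C hC
  rw [← hC.closure_sdiff_singleton_eq b] at h1
  refine M.closure_subset_closure ?_ h1
  rintro x ⟨hx, hxb⟩
  exact (hCI hx).resolve_left hxb

theorem IsFreeSeparator.of_subset_of_disjoint {M : Matroid α} {A A' B : Set α}
    (h : IsFreeSeparator M A) (h' : IsFreeSeparator M A') (hd : Disjoint A A')
    (hne' : A'.Nonempty) (hB : B ⊆ A) : IsFreeSeparator M B :=
  ⟨hB.trans h.1, fun _ hC => .inr (hB.trans (subset_closure_of_disjoint h h' hd hne' hC))⟩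

/-- A nonempty freely connected restriction to one of two disjoint nonempty free separators is a
single element, because every subset is a free separator. -/
theorem exists_eq_singleton_of_disjoint {M : Matroid α} {A A' : Set α}
    (h : IsFreeSeparator M A) (h' : IsFreeSeparator M A') (hd : Disjoint A A')
    (hne : A.Nonempty) (hne' : A'.Nonempty) (hA : IsFreelyConnected (M ↾ A)) :
    ∃ a, A = {a} := by
  obtain ⟨a, ha⟩ := hne
  have h1 := (h.of_subset_of_disjoint h' hd hne' (singleton_subset_iff.2 ha)).restrict
    (singleton_subset_iff.2 ha) h.1
  rcases hA _ h1 with h2 | h2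
  · exact absurd h2 (singleton_ne_empty a)
  · exact ⟨a, h2.symm⟩

/-- If every circuit spans both `a` and `b`, then the transposition of `a` and `b` is an
automorphism of `M`. -/
theorem map_swap_eq_self {M : Matroid α} [DecidableEq α] {a b : α} (ha : a ∈ M.E) (hb : b ∈ M.E)
    (hspan : ∀ C, M.IsCircuit C → a ∈ M.closure C ∧ b ∈ M.closure C) :
    M.map (Equiv.swap a b) (Equiv.swap a b).injective.injOn = M := by
  have key : ∀ I, M.Indep I → M.Indep (Equiv.swap a b '' I) := by
    intro I hI
    by_cases haI : a ∈ I <;> by_cases hbI : b ∈ I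
    · convert hI using 1
      exact (Equiv.swap_bijOn_self (iff_of_true haI hbI)).image_eq
    · rw [(Equiv.swap_bijOn_exchange haI hbI).image_eq]
      exact indep_exchange hb (fun C hC => (hspan C hC).1) hI haI
    · rw [Equiv.swap_comm, (Equiv.swap_bijOn_exchange hbI haI).image_eq]
      exact indep_exchange ha (fun C hC => (hspan C hC).2) hI hbI
    · convert hI using 1
      exact (Equiv.swap_bijOn_self (iff_of_false haI hbI)).image_eq
  have hinv : ∀ X : Set α, Equiv.swap a b '' (Equiv.swap a b '' X) = X := fun X => by
    rw [← image_comp]; simp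
  refine Matroid.ext_indep ((Equiv.swap_bijOn_self (iff_of_true ha hb)).image_eq) fun I _ => ?_
  rw [Matroid.map_indep_iff]
  constructor
  · rintro ⟨J, hJ, rfl⟩
    exact key J hJ
  · exact fun h => ⟨_, key I h, (hinv I).symm⟩

/-- Two nonempty free separators, on each of which `M` is freely connected, are exchanged by an
automorphism of `M`: they are equal, or they are single elements that may be swapped. -/
theorem exists_automorphism {M : Matroid α} {A A' : Set α}
    (h : IsFreeSeparator M A) (h' : IsFreeSeparator M A') (hne : A.Nonempty) (hne' : A'.Nonempty)
    (hA : IsFreelyConnected (M ↾ A)) (hA' : IsFreelyConnected (M ↾ A')) :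
    ∃ τ : Equiv.Perm α, M.map τ τ.injective.injOn = M ∧ τ '' A = A' := by
  classical
  have h1 := h.inter h'
  rcases hA _ (h1.restrict inter_subset_left h.1) with h2 | h2
  · have hd : Disjoint A A' := disjoint_iff_inter_eq_empty.2 h2
    obtain ⟨a, rfl⟩ := exists_eq_singleton_of_disjoint h h' hd hne hne' hA
    obtain ⟨b, rfl⟩ := exists_eq_singleton_of_disjoint h' h hd.symm hne' hne hA'
    refine ⟨Equiv.swap a b, map_swap_eq_self (h.1 rfl) (h'.1 rfl) fun C hC => ?_, by simp⟩
    exact ⟨subset_closure_of_disjoint h h' hd hne' hC rfl,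
      subset_closure_of_disjoint h' h hd.symm hne hC rfl⟩
  · rcases hA' _ (h1.restrict inter_subset_right h'.1) with h3 | h3
    · exact absurd (h2.symm.trans h3) hne.ne_empty
    · refine ⟨1, ?_, by simpa using h2.symm.trans h3⟩
      exact M.map_id

/-! ### Isomorphism by injective maps -/

theorem isIso_map (M : Matroid α) {f : α → β} (hf : InjOn f M.E) : IsIso M (M.map f hf) := by
  refine ⟨Equiv.Set.imageOfInjOn f M.E hf, fun I => ?_⟩
  have h : (Subtype.val '' (Equiv.Set.imageOfInjOn f M.E hf '' I) : Set β)
      = f '' (Subtype.val '' I) := by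
    rw [← image_comp, ← image_comp]; rfl
  have hI : (Subtype.val '' I : Set α) ⊆ M.E := by rintro _ ⟨x, -, rfl⟩; exact x.2
  refine (M.map_image_indep_iff (hf := hf) hI).symm.trans (iff_of_eq (congrArg _ h.symm))

/-- Isomorphic matroids are images of one matroid under injective maps. -/
theorem IsIso.exists_map {M : Matroid α} {N : Matroid β} (h : IsIso M N) :
    ∃ (γ : Type u) (R : Matroid γ) (f : γ → α) (g : γ → β) (hf : f.Injective) (hg : g.Injective),
      M = R.map f hf.injOn ∧ N = R.map g hg.injOn := by
  obtain ⟨e, he⟩ := h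
  refine ⟨M.E, M.restrictSubtype M.E, Subtype.val, fun x => e x, Subtype.val_injective,
    Subtype.val_injective.comp e.injective, M.map_val_restrictSubtype_ground_eq.symm, ?_⟩
  have hr : ∀ I : Set M.E, Subtype.val '' (e '' I) = (fun x => (e x : β)) '' I := fun I => by
    rw [← image_comp]; rfl
  refine Matroid.ext_indep ?_ fun J hJ => ?_
  · simp only [Matroid.map_ground, Matroid.restrictSubtype_ground, ← hr]
    simp
  · obtain ⟨I, rfl⟩ : ∃ I : Set M.E, J = Subtype.val '' (e '' I) := by
      refine ⟨e.symm '' (Subtype.val ⁻¹' J), ?_⟩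
      rw [← image_comp e e.symm]
      simpa using hJ
    rw [← he, hr, Matroid.map_image_indep_iff (by simp), Matroid.restrictSubtype_indep_iff]

theorem map_restrict {M : Matroid α} {f : α → β} (hf : f.Injective) {A : Set α} :
    (M.map f hf.injOn) ↾ (f '' A) = (M ↾ A).map f hf.injOn := by
  refine Matroid.ext_indep rfl fun I _ => ?_
  simp only [Matroid.restrict_indep_iff, Matroid.map_indep_iff]
  constructor
  · rintro ⟨⟨J, hJ, rfl⟩, h⟩
    exact ⟨J, ⟨hJ, (image_subset_image_iff hf).1 h⟩, rfl⟩
  · rintro ⟨J, ⟨hJ, h⟩, rfl⟩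
    exact ⟨⟨J, hJ, rfl⟩, image_mono h⟩

theorem map_contract {M : Matroid α} {f : α → β} (hf : f.Injective) {A : Set α} :
    (M.map f hf.injOn) ／ (f '' A) = (M ／ A).map f hf.injOn := by
  rw [← Matroid.dual_inj, Matroid.dual_contract, Matroid.map_dual, Matroid.map_dual]
  simp only [Matroid.dual_contract, ← Matroid.restrict_compl, ← map_restrict hf,
    image_sdiff hf]
  rfl

/-! ### Rank, restriction and contraction in a free product -/

theorem preimage_inl_subset (P : Matroid α) (Q : Matroid β) {A : Set (α ⊕ β)}
    (hA : A ⊆ ground P Q) :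
    Sum.inl ⁻¹' A ⊆ P.E := fun _ h => inl_mem_ground.1 (hA h)

theorem preimage_inr_subset (P : Matroid α) (Q : Matroid β) {A : Set (α ⊕ β)}
    (hA : A ⊆ ground P Q) :
    Sum.inr ⁻¹' A ⊆ Q.E := fun _ h => inr_mem_ground.1 (hA h)

section

variable (P : Matroid α) (Q : Matroid β) [P.Finite] [Q.Finite]

/-- The rank function of the free product. -/
theorem rk_freeProduct {A : Set (α ⊕ β)} (hA : A ⊆ ground P Q) :
    rk (freeProduct P Q) A = min (rk P (Sum.inl ⁻¹' A) + (Sum.inr ⁻¹' A).ncard)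
      (rk P P.E + rk Q (Sum.inr ⁻¹' A)) := by
  have hAf := (ground_finite P Q).subset hA
  have hTf : (Sum.inr ⁻¹' A : Set β).Finite := hAf.preimage Sum.inr_injective.injOn
  apply le_antisymm
  · obtain ⟨I, hI⟩ := (freeProduct P Q).exists_isBasis A hA
    have hr : rk (freeProduct P Q) A = I.ncard := by
      rw [← rk_indep hI.indep, rk, rk, hI.eRk_eq_eRk]
    obtain ⟨-, hi, hc⟩ := indep_iff.1 ((freeProduct_indep P Q I).1 hI.indep)
    have h1 := rk_mono P (preimage_mono (f := Sum.inl) hI.subset)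
    have h2 := rk_mono Q (preimage_mono (f := Sum.inr) hI.subset)
    have h3 := ncard_le_ncard (preimage_mono (f := Sum.inr) hI.subset) hTf
    have h4 := ncard_sum (hAf.subset hI.subset)
    rw [rk_indep hi] at h1
    omega
  · obtain ⟨I, hI⟩ := P.exists_isBasis (Sum.inl ⁻¹' A) (preimage_inl_subset P Q hA)
    obtain ⟨K, hK⟩ := Q.exists_isBasis (Sum.inr ⁻¹' A) (preimage_inr_subset P Q hA)
    have hIr : rk P (Sum.inl ⁻¹' A) = I.ncard := by
      rw [← rk_indep hI.indep, rk, rk, hI.eRk_eq_eRk]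
    have hKr : rk Q (Sum.inr ⁻¹' A) = K.ncard := by
      rw [← rk_indep hK.indep, rk, rk, hK.eRk_eq_eRk]
    have h1 := rk_mono P (preimage_inl_subset P Q hA)
    have h2 := rk_le_ncard Q hTf
    -- enlarge the basis `K` of the second part as far as the rank-lack of `I` allows
    obtain ⟨J, hKJ, hJA, hJc⟩ := exists_subsuperset_card_eq
      (n := min (Sum.inr ⁻¹' A).ncard (rk P P.E + K.ncard - I.ncard)) hK.subset
      (by omega) (by omega)
    have hl : Sum.inl ⁻¹' (Sum.inl '' I ∪ Sum.inr '' J : Set (α ⊕ β)) = I := by ext; simp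
    have hr : Sum.inr ⁻¹' (Sum.inl '' I ∪ Sum.inr '' J : Set (α ⊕ β)) = J := by ext; simp
    have hsub : (Sum.inl '' I ∪ Sum.inr '' J : Set (α ⊕ β)) ⊆ A :=
      union_subset (image_subset_iff.2 hI.subset) (image_subset_iff.2 hJA)
    have hcard := ncard_sum (hAf.subset hsub)
    rw [hl, hr] at hcard
    have h3 := rk_mono Q hKJ
    rw [rk_indep hK.indep] at h3
    have hind : (freeProduct P Q).Indep (Sum.inl '' I ∪ Sum.inr '' J) := by
      rw [freeProduct_indep, indep_iff, hl, hr]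
      exact ⟨hsub.trans hA, hI.indep, by omega⟩
    have h4 := rk_mono (freeProduct P Q) hsub
    rw [rk_indep hind] at h4
    omega

theorem rk_freeProduct_ground :
    rk (freeProduct P Q) (freeProduct P Q).E = rk P P.E + rk Q Q.E := by
  rw [freeProduct_E, rk_freeProduct P Q subset_rfl]
  have hl : Sum.inl ⁻¹' (ground P Q) = P.E := by ext; simp
  have hr : Sum.inr ⁻¹' (ground P Q) = Q.E := by ext; simp
  have := rk_le_ncard Q Q.ground_finite
  rw [hl, hr]
  omega

theorem freeProduct_restrict_left :
    freeProduct P Q ↾ (Sum.inl '' P.E) = P.map Sum.inl Sum.inl_injective.injOn := by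
  refine Matroid.ext_indep rfl fun I hI => ?_
  obtain ⟨J, hJ, rfl⟩ := subset_image_iff.1 hI
  have hl : Sum.inl ⁻¹' (Sum.inl '' J : Set (α ⊕ β)) = J := by ext; simp
  have hr : Sum.inr ⁻¹' (Sum.inl '' J : Set (α ⊕ β)) = ∅ := by ext; simp
  rw [Matroid.map_image_indep_iff hJ, Matroid.restrict_indep_iff, freeProduct_indep, indep_iff,
    hl, hr, ncard_image_of_injective _ Sum.inl_injective]
  refine ⟨fun h => h.1.2.1, fun h => ⟨⟨hI.trans subset_union_left, h, ?_⟩, hI⟩⟩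
  have := rk_mono P hJ
  rw [rk_indep h] at this
  omega

theorem freeProduct_contract_left :
    freeProduct P Q ／ (Sum.inl '' P.E) = Q.map Sum.inr Sum.inr_injective.injOn := by
  have hE : (freeProduct P Q ／ (Sum.inl '' P.E)).E = Sum.inr '' Q.E := by
    rw [Matroid.contract_ground, freeProduct_E]
    ext x; cases x <;> simp
  refine Matroid.ext_indep hE fun I hI => ?_
  rw [hE] at hI
  obtain ⟨J, hJ, rfl⟩ := subset_image_iff.1 hI
  have hsub : (Sum.inl '' P.E ∪ Sum.inr '' J : Set (α ⊕ β)) ⊆ ground P Q :=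
    union_subset_union_right _ hI
  have hl : Sum.inl ⁻¹' (Sum.inl '' P.E ∪ Sum.inr '' J : Set (α ⊕ β)) = P.E := by ext; simp
  have hr : Sum.inr ⁻¹' (Sum.inl '' P.E ∪ Sum.inr '' J : Set (α ⊕ β)) = J := by ext; simp
  have hl' : Sum.inl ⁻¹' (Sum.inl '' P.E : Set (α ⊕ β)) = P.E := by ext; simp
  have hr' : Sum.inr ⁻¹' (Sum.inl '' P.E : Set (α ⊕ β)) = ∅ := by ext; simp
  have hP : Sum.inl '' P.E ⊆ (freeProduct P Q).E := subset_union_left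
  rw [Matroid.map_image_indep_iff hJ, contract_indep_iff_rk _ hP, ← Matroid.contract_ground, hE,
    and_iff_right hI,
    rk_freeProduct _ _ hsub, rk_freeProduct P Q hP, hl, hr, hl', hr',
    ncard_image_of_injective _ Sum.inr_injective, indep_iff_rk Q hJ, ncard_empty]
  omega

theorem isFreeSeparator_freeProduct : IsFreeSeparator (freeProduct P Q) (Sum.inl '' P.E) := by
  rw [isFreeSeparator_iff_rk]
  refine ⟨subset_union_left, fun I hI hIP hr => ?_⟩
  rw [freeProduct_E] at hI
  rw [freeProduct_indep, indep_iff]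
  have h1 : Sum.inl ⁻¹' (I ∩ Sum.inl '' P.E) = Sum.inl ⁻¹' I := by
    ext x
    simpa using fun h : Sum.inl x ∈ I => inl_mem_ground.1 (hI h)
  have h2 : Sum.inr ⁻¹' (Sum.inl '' P.E ∪ I) = Sum.inr ⁻¹' I := by ext; simp
  refine ⟨hI, h1 ▸ ((freeProduct_indep P Q _).1 hIP).2.1, hr.trans ?_⟩
  rw [rk_freeProduct P Q (union_subset subset_union_left hI), h2]
  exact min_le_right _ _

end

/-- A free separator of `M` splits `M` as a free product. -/
theorem IsFreeSeparator.isIso {M : Matroid α} [M.Finite] {A : Set α} [(M ↾ A).Finite]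
    (h : IsFreeSeparator M A) : IsIso (freeProduct (M ↾ A) (M ／ A)) M := by
  have hinj : InjOn (Sum.elim id id) (freeProduct (M ↾ A) (M ／ A)).E := by
    rw [freeProduct_E]
    rintro (x | x) hx (y | y) hy hxy
    · exact congrArg _ hxy
    · obtain rfl : x = y := hxy
      exact ((inr_mem_ground.1 hy).2 (inl_mem_ground.1 hx)).elim
    · obtain rfl : x = y := hxy
      exact ((inr_mem_ground.1 hx).2 (inl_mem_ground.1 hy)).elim
    · exact congrArg _ hxy
  -- `Sum.elim id id` identifies the disjoint union of `A` and its complement with the ground set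
  suffices hM : (freeProduct (M ↾ A) (M ／ A)).map (Sum.elim id id) hinj = M by
    conv_rhs => rw [← hM]
    exact isIso_map _ hinj
  have himage : ∀ J : Set (α ⊕ α), Sum.elim id id '' J = Sum.inl ⁻¹' J ∪ Sum.inr ⁻¹' J := by
    intro J
    ext x
    simp
  have hE : Sum.elim id id '' (ground (M ↾ A) (M ／ A)) = M.E := by
    rw [himage]
    ext x
    by_cases hx : x ∈ A
    · simp [hx, h.1 hx]
    · simp [hx]
  refine Matroid.ext_indep hE fun I hI => ?_
  obtain ⟨J, hJ, rfl⟩ := subset_image_iff.1 (hI : I ⊆ Sum.elim id id '' _)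
  rw [Matroid.map_image_indep_iff hJ, freeProduct_indep, indep_iff, himage,
    and_iff_right (show J ⊆ ground _ _ from hJ), Matroid.restrict_indep_iff]
  have hJl : Sum.inl ⁻¹' J ⊆ A := preimage_inl_subset (M ↾ A) (M ／ A) hJ
  have hJr : Sum.inr ⁻¹' J ⊆ M.E \ A := preimage_inr_subset (M ↾ A) (M ／ A) hJ
  have hJE : Sum.inl ⁻¹' J ∪ Sum.inr ⁻¹' J ⊆ M.E :=
    union_subset (hJl.trans h.1) (hJr.trans sdiff_subset)
  have hcard : J.ncard = (Sum.inl ⁻¹' J ∪ Sum.inr ⁻¹' J).ncard := by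
    rw [← himage, (hinj.mono hJ).ncard_image]
  have hrk : rk M A + rk (M ／ A) (Sum.inr ⁻¹' J) = rk M (A ∪ (Sum.inl ⁻¹' J ∪ Sum.inr ⁻¹' J)) := by
    rw [rk_contract M h.1 hJr, ← union_assoc, union_eq_self_of_subset_right hJl]
  have hinter : (Sum.inl ⁻¹' J ∪ Sum.inr ⁻¹' J) ∩ A = Sum.inl ⁻¹' J := by
    rw [union_inter_distrib_right, inter_eq_self_of_subset_left hJl,
      (disjoint_sdiff_left.mono_left hJr).inter_eq, union_empty]
  rw [and_iff_left hJl, Matroid.restrict_ground_eq, rk_restrict M subset_rfl, hrk, hcard]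
  constructor
  · exact fun hi => (isFreeSeparator_iff_rk M).1 h |>.2 _ hJE (hinter.symm ▸ hi.1) hi.2
  · exact fun hi => ⟨hi.subset subset_union_left,
      ((indep_iff_rk M hJE).1 hi).trans (rk_mono M subset_union_right)⟩

/-- Both associations give the sets `A` whose parts `a`, `b`, `c` satisfy: `a` is independent,
`|a| + |b| ≤ ρ(M) + ρ_N(b)` and `|a| + |b| + |c| ≤ ρ(M) + ρ(N) + ρ_R(c)`. -/
theorem isIso_freeProduct_assoc (M : Matroid α) (N : Matroid β) (R : Matroid γ)
    [M.Finite] [N.Finite] [R.Finite] :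
    IsIso (freeProduct (freeProduct M N) R) (freeProduct M (freeProduct N R)) := by
  have hinj := (Equiv.sumAssoc α β γ).injective
  suffices h : (freeProduct (freeProduct M N) R).map (Equiv.sumAssoc α β γ) hinj.injOn
      = freeProduct M (freeProduct N R) from h ▸ isIso_map _ _
  have hE : Equiv.sumAssoc α β γ '' ground (freeProduct M N) R = ground M (freeProduct N R) := by
    ext x
    rw [Equiv.image_eq_preimage_symm]
    rcases x with x | x | x <;> simp [freeProduct_E]
  refine Matroid.ext_indep hE fun I hI => ?_
  obtain ⟨A, hA, rfl⟩ := subset_image_iff.1 (hI : I ⊆ _ '' ground (freeProduct M N) R)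
  have hA' : Equiv.sumAssoc α β γ '' A ⊆ ground M (freeProduct N R) := hE ▸ image_mono hA
  have hAf := (ground_finite (freeProduct M N) R).subset hA
  rw [Matroid.map_image_indep_iff hA, freeProduct_indep, freeProduct_indep, indep_iff, indep_iff,
    and_iff_right (show A ⊆ ground _ R from hA), and_iff_right hA', freeProduct_indep, indep_iff,
    rk_freeProduct_ground,
    and_iff_right (show _ ⊆ ground M N from preimage_inl_subset (freeProduct M N) R hA),
    rk_freeProduct _ _ (preimage_inr_subset M (freeProduct N R) hA'),
    ncard_image_of_injective _ hinj, ncard_sum hAf,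
    ncard_sum (hAf.preimage Sum.inl_injective.injOn)]
  have h1 : Sum.inl ⁻¹' (Equiv.sumAssoc α β γ '' A) = Sum.inl ⁻¹' (Sum.inl ⁻¹' A) := by
    ext; simp [Equiv.image_eq_preimage_symm]
  have h2 : Sum.inl ⁻¹' (Sum.inr ⁻¹' (Equiv.sumAssoc α β γ '' A))
      = Sum.inr ⁻¹' (Sum.inl ⁻¹' A) := by
    ext; simp [Equiv.image_eq_preimage_symm]
  have h3 : Sum.inr ⁻¹' (Sum.inr ⁻¹' (Equiv.sumAssoc α β γ '' A)) = Sum.inr ⁻¹' A := by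
    ext; simp [Equiv.image_eq_preimage_symm]
  rw [h1, h2, h3, and_assoc]
  refine and_congr_right fun _ => ?_
  omega

/-! ### Cancellation of freely connected left factors -/

theorem IsIso.ncard_ground_eq {M : Matroid α} {N : Matroid β} (h : IsIso M N) :
    M.E.ncard = N.E.ncard := by
  obtain ⟨e, -⟩ := h
  exact Nat.card_congr e

theorem IsIso.ground_nonempty {M : Matroid α} {N : Matroid β} (h : IsIso M N)
    (hM : M.E.Nonempty) : N.E.Nonempty := by
  obtain ⟨e, -⟩ := h
  obtain ⟨x, hx⟩ := hM
  exact ⟨_, (e ⟨x, hx⟩).2⟩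

theorem isIso_of_ground_eq_empty {M : Matroid α} {N : Matroid β} (hM : M.E = ∅) (hN : N.E = ∅) :
    IsIso M N := by
  have : IsEmpty M.E := isEmpty_coe_sort.2 hM
  have : IsEmpty N.E := isEmpty_coe_sort.2 hN
  refine ⟨Equiv.equivOfIsEmpty _ _, fun I => ?_⟩
  simp [eq_empty_of_isEmpty I]

theorem finite_of_map {R : Matroid γ} {f : γ → α} (hf : f.Injective)
    (h : (R.map f hf.injOn).Finite) : R.Finite :=
  ⟨h.ground_finite.of_finite_image hf.injOn⟩

theorem isFreelyConnected_map_iff {M : Matroid α} [M.Finite] {f : α → β} (hf : f.Injective) :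
    IsFreelyConnected (M.map f hf.injOn) ↔ IsFreelyConnected M := by
  constructor
  · intro h A hA
    have h1 := h _ ((isFreeSeparator_map_iff hf hA.1).2 hA)
    rwa [image_eq_empty, Matroid.map_ground, hf.image_injective.eq_iff] at h1
  · intro h B hB
    obtain ⟨A, hA, rfl⟩ := subset_image_iff.1 hB.1
    rw [image_eq_empty, Matroid.map_ground, hf.image_injective.eq_iff]
    exact h A ((isFreeSeparator_map_iff hf hA).1 hB)

theorem IsIso.isFreelyConnected {M : Matroid α} {N : Matroid β} [hM : M.Finite]
    (h : IsIso M N) (hc : IsFreelyConnected M) : IsFreelyConnected N := by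
  obtain ⟨γ, R, f, g, hf, hg, rfl, rfl⟩ := h.exists_map
  have := finite_of_map hf hM
  rwa [isFreelyConnected_map_iff hg, ← isFreelyConnected_map_iff hf]

/-- A free product structure on an injective image of `R` comes from a free separator of `R`. -/
theorem exists_isFreeSeparator_of_eq_map {P : Matroid α} {Q : Matroid β} [P.Finite] [Q.Finite]
    {R : Matroid γ} [R.Finite] {f : γ → α ⊕ β} (hf : f.Injective)
    (h : freeProduct P Q = R.map f hf.injOn) :
    ∃ A, IsFreeSeparator R A ∧ IsIso P (R ↾ A) ∧ IsIso Q (R ／ A) := by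
  have hE : Sum.inl '' P.E ⊆ f '' R.E := by
    rw [← Matroid.map_ground R f hf.injOn, ← h]
    exact subset_union_left
  obtain ⟨A, hA, hAE⟩ := subset_image_iff.1 hE
  refine ⟨A, ?_, ?_, ?_⟩
  · rw [← isFreeSeparator_map_iff hf hA, hAE, ← h]
    exact isFreeSeparator_freeProduct P Q
  · refine (isIso_map P (Sum.inl_injective (β := β)).injOn).trans ?_
    rw [← freeProduct_restrict_left P Q, h, ← hAE, map_restrict hf]
    exact (isIso_map _ _).symm
  · refine (isIso_map Q (Sum.inr_injective (α := α)).injOn).trans ?_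
    rw [← freeProduct_contract_left P Q, h, ← hAE, map_contract hf]
    exact (isIso_map _ _).symm

/-- If two free products are isomorphic and their left factors are nonempty and freely connected,
then the left factors are isomorphic, and so are the right factors. -/
theorem isIso_and_isIso_of_isIso_freeProduct {α' : Type*} {β' : Type*} {P : Matroid α}
    {Q : Matroid β} {P' : Matroid α'} {Q' : Matroid β'} [P.Finite] [Q.Finite] [P'.Finite]
    [Q'.Finite] (h : IsIso (freeProduct P Q) (freeProduct P' Q')) (hP : P.E.Nonempty)
    (hP' : P'.E.Nonempty) (hPc : IsFreelyConnected P) (hPc' : IsFreelyConnected P') :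
    IsIso P P' ∧ IsIso Q Q' := by
  obtain ⟨γ, R, f, g, hf, hg, h1, h2⟩ := h.exists_map
  have := finite_of_map hf (h1 ▸ freeProduct_finite P Q)
  obtain ⟨A, hA, hPA, hQA⟩ := exists_isFreeSeparator_of_eq_map hf h1
  obtain ⟨A', hA', hPA', hQA'⟩ := exists_isFreeSeparator_of_eq_map hg h2
  obtain ⟨τ, hτ, hτA⟩ := exists_automorphism hA hA' (hPA.ground_nonempty hP)
    (hPA'.ground_nonempty hP') (hPA.isFreelyConnected hPc) (hPA'.isFreelyConnected hPc')
  have hr : IsIso (R ↾ A) (R ↾ A') := by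
    have := isIso_map (R ↾ A) τ.injective.injOn
    rwa [← map_restrict τ.injective, hτ, hτA] at this
  have hc : IsIso (R ／ A) (R ／ A') := by
    have := isIso_map (R ／ A) τ.injective.injOn
    rwa [← map_contract τ.injective, hτ, hτA] at this
  exact ⟨(hPA.trans hr).trans hPA'.symm, (hQA.trans hc).trans hQA'.symm⟩

theorem isIso_freeProduct_of_left_empty {P : Matroid α} (Q : Matroid β) [P.Finite] [Q.Finite]
    (hP : P.E = ∅) : IsIso (freeProduct P Q) Q := by
  have h := freeProduct_contract_left P Q
  rw [hP, image_empty, Matroid.contract_empty] at h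
  exact h ▸ (isIso_map Q _).symm

theorem isIso_freeProduct_of_right_empty (P : Matroid α) {Q : Matroid β} [P.Finite] [Q.Finite]
    (hQ : Q.E = ∅) : IsIso (freeProduct P Q) P := by
  have hE : Sum.inl '' P.E = (freeProduct P Q).E := by
    simp [freeProduct_E, ground, hQ]
  have h := freeProduct_restrict_left P Q
  rw [hE, Matroid.restrict_ground_eq_self] at h
  exact h ▸ (isIso_map P _).symm

end FreeProd

/-! ### The monoid of isomorphism classes -/

namespace MatroidClass

theorem mk_eq_mk {M N : FinMatroid.{u}} : mk M = mk N ↔ M.Iso N := Quotient.eq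

theorem mk_eq_one {M : FinMatroid.{u}} : mk M = 1 ↔ M.matroid.E = ∅ := by
  refine mk_eq_mk.trans ⟨fun h => ?_, fun h => FreeProd.isIso_of_ground_eq_empty h rfl⟩
  by_contra hne
  obtain ⟨x, -⟩ := FreeProd.IsIso.ground_nonempty h (nonempty_iff_ne_empty.2 hne)
  exact x.elim

/-- The classes form a monoid for the operation induced by the free product. -/
noncomputable instance : Monoid MatroidClass.{u} where
  mul_assoc := by
    rintro ⟨M⟩ ⟨N⟩ ⟨R⟩
    exact mk_eq_mk.2 (FreeProd.isIso_freeProduct_assoc M.matroid N.matroid R.matroid)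
  one_mul := by
    rintro ⟨M⟩
    exact mk_eq_mk.2 (FreeProd.isIso_freeProduct_of_left_empty M.matroid rfl)
  mul_one := by
    rintro ⟨M⟩
    exact mk_eq_mk.2 (FreeProd.isIso_freeProduct_of_right_empty M.matroid rfl)

theorem mk_freeProductList (L : List FinMatroid.{u}) :
    mk (FinMatroid.freeProductList L) = (L.map mk).prod := by
  induction L with
  | nil => rfl
  | cons M L ih => rw [List.map_cons, List.prod_cons, ← ih]; rfl

end MatroidClass

namespace FinMatroid

open scoped Matroid
open MatroidClass FreeProd

/-- The restriction of a matroid to a subset of its ground set. -/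
def restrict (M : FinMatroid.{u}) (A : Set M.carrier) (hA : A ⊆ M.matroid.E) : FinMatroid.{u} :=
  ⟨M.carrier, M.matroid ↾ A, ⟨M.matroid.ground_finite.subset hA⟩⟩

/-- The contraction of a set in a matroid. -/
def contract (M : FinMatroid.{u}) (A : Set M.carrier) : FinMatroid.{u} :=
  ⟨M.carrier, M.matroid ／ A, inferInstance⟩

theorem mk_restrict_mul_mk_contract (M : FinMatroid.{u}) {A : Set M.carrier}
    (hA : IsFreeSeparator M.matroid A) :
    MatroidClass.mk (M.restrict A hA.1) * MatroidClass.mk (M.contract A) = MatroidClass.mk M := by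
  have : (M.matroid ↾ A).Finite := (M.restrict A hA.1).finite
  exact mk_eq_mk.2 hA.isIso

theorem ncard_restrict_lt (M : FinMatroid.{u}) {A : Set M.carrier} (hA : A ⊆ M.matroid.E)
    (hne : A ≠ M.matroid.E) : (M.restrict A hA).matroid.E.ncard < M.matroid.E.ncard :=
  ncard_lt_ncard (hA.ssubset_of_ne hne) M.matroid.ground_finite

theorem ncard_contract_lt (M : FinMatroid.{u}) {A : Set M.carrier} (hA : A ⊆ M.matroid.E)
    (hne : A ≠ ∅) : (M.contract A).matroid.E.ncard < M.matroid.E.ncard :=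
  ncard_lt_ncard (hA.sdiff_ssubset_of_nonempty (nonempty_iff_ne_empty.2 hne))
    M.matroid.ground_finite

/-- Irreducibility in terms of free separators. A nontrivial free separator gives a factorization
into two strictly smaller matroids, neither of which can be isomorphic to the whole. -/
theorem irreducible_iff {M : FinMatroid.{u}} :
    M.Irreducible ↔ M.matroid.E.Nonempty ∧ IsFreelyConnected M.matroid := by
  refine and_congr_right fun hne => ⟨fun h A hA => ?_, fun h L hL => ?_⟩
  · by_contra! hcon
    obtain ⟨P, hP, hPM⟩ := h [M.restrict A hA.1, M.contract A] (by
      rw [← mk_eq_mk, mk_freeProductList, ← mk_restrict_mul_mk_contract M hA]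
      simp)
    have hcard := IsIso.ncard_ground_eq hPM
    simp only [List.mem_cons, List.not_mem_nil, or_false] at hP
    rcases hP with rfl | rfl
    · exact (M.ncard_restrict_lt hA.1 hcon.2).ne hcard
    · exact (M.ncard_contract_lt hA.1 hcon.1.ne_empty).ne hcard
  · induction L with
    | nil =>
      obtain ⟨x, -⟩ := IsIso.ground_nonempty hL hne
      exact x.elim
    | cons P L ih =>
      have hc := IsIso.isFreelyConnected hL h
      -- the ground set of the first factor is a free separator, so one of the two parts is empty
      rcases hc _ (isFreeSeparator_freeProduct P.matroid (freeProductList L).matroid) with h1 | h1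
      · have hP : P.matroid.E = ∅ := image_eq_empty.1 h1
        obtain ⟨P', hP', hP'M⟩ := ih
          (IsIso.trans hL (isIso_freeProduct_of_left_empty (freeProductList L).matroid hP))
        exact ⟨P', List.mem_cons_of_mem _ hP', hP'M⟩
      · have hQ : (freeProductList L).matroid.E = ∅ := by
          refine eq_empty_of_forall_notMem fun x hx => ?_
          have hx' : Sum.inr x ∈ ground P.matroid (freeProductList L).matroid :=
            inr_mem_ground.2 hx
          obtain ⟨y, -, hy⟩ := h1.ge hx'
          cases hy
        exact ⟨P, List.mem_cons_self,
          (IsIso.trans hL (isIso_freeProduct_of_right_empty P.matroid hQ)).symm⟩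

end FinMatroid

namespace MatroidClass

open FreeProd

/-! ### Unique factorization -/

theorem mul_ne_one_of_mem_irreducibles {c : MatroidClass.{u}} (hc : c ∈ irreducibles)
    (x : MatroidClass.{u}) : c * x ≠ 1 := by
  obtain ⟨M, hM, rfl⟩ := hc
  obtain ⟨N⟩ := x
  obtain ⟨a, ha⟩ := hM.1
  intro h
  have h1 : (M.freeProduct N).matroid.E = ∅ := mk_eq_one.1 h
  exact notMem_empty _
    (h1.le (inl_mem_ground.2 ha : Sum.inl a ∈ ground M.matroid N.matroid))

/-- The irreducible left factor of a product is determined by the product, and so is the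
cofactor. -/
theorem eq_and_eq_of_mul_eq_mul {c d x y : MatroidClass.{u}} (hc : c ∈ irreducibles)
    (hd : d ∈ irreducibles) (h : c * x = d * y) : c = d ∧ x = y := by
  obtain ⟨M, hM, rfl⟩ := hc
  obtain ⟨N, hN, rfl⟩ := hd
  obtain ⟨X⟩ := x
  obtain ⟨Y⟩ := y
  rw [FinMatroid.irreducible_iff] at hM hN
  have := isIso_and_isIso_of_isIso_freeProduct (mk_eq_mk.1 h) hM.1 hN.1 hM.2 hN.2
  exact ⟨mk_eq_mk.2 this.1, mk_eq_mk.2 this.2⟩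

/-- A product of irreducible classes determines the sequence of its factors. -/
theorem eq_of_prod_eq_prod {l l' : List MatroidClass.{u}} (hl : ∀ c ∈ l, c ∈ irreducibles)
    (hl' : ∀ c ∈ l', c ∈ irreducibles) (h : l.prod = l'.prod) : l = l' := by
  induction l generalizing l' with
  | nil =>
    cases l' with
    | nil => rfl
    | cons d l' =>
      exact (mul_ne_one_of_mem_irreducibles (hl' d List.mem_cons_self) l'.prod
        (by rw [← List.prod_cons, ← h, List.prod_nil])).elim
  | cons c l ih =>
    cases l' with
    | nil =>
      exact (mul_ne_one_of_mem_irreducibles (hl c List.mem_cons_self) l.prod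
        (by rw [← List.prod_cons, h, List.prod_nil])).elim
    | cons d l' =>
      rw [List.prod_cons, List.prod_cons] at h
      obtain ⟨rfl, h2⟩ := eq_and_eq_of_mul_eq_mul (hl c List.mem_cons_self)
        (hl' d List.mem_cons_self) h
      rw [ih (fun c hc => hl c (List.mem_cons_of_mem _ hc))
        (fun c hc => hl' c (List.mem_cons_of_mem _ hc)) h2]

/-- Every matroid is, up to isomorphism, a free product of irreducible ones: a reducible nonempty
matroid splits along a nontrivial free separator into two smaller matroids. -/
theorem closure_irreducibles : Submonoid.closure irreducibles.{u} = ⊤ := by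
  refine (Submonoid.eq_top_iff' _).2 fun c => ?_
  obtain ⟨M⟩ := c
  change mk M ∈ Submonoid.closure irreducibles
  induction h : M.matroid.E.ncard using Nat.strong_induction_on generalizing M with
  | _ n ih =>
    subst h
    by_cases hM : M.Irreducible
    · exact Submonoid.subset_closure ⟨M, hM, rfl⟩
    by_cases hE : M.matroid.E = ∅
    · rw [mk_eq_one.2 hE]
      exact one_mem _
    have hc : ¬ IsFreelyConnected M.matroid := fun hc =>
      hM (FinMatroid.irreducible_iff.2 ⟨nonempty_iff_ne_empty.2 hE, hc⟩)
    simp only [IsFreelyConnected, not_forall, not_or] at hc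
    obtain ⟨A, hA, hne, hne'⟩ := hc
    rw [← FinMatroid.mk_restrict_mul_mk_contract M hA]
    exact mul_mem (ih _ (M.ncard_restrict_lt hA.1 hne') _ rfl)
      (ih _ (M.ncard_contract_lt hA.1 hne) _ rfl)

theorem bijective_lift_irreducibles :
    Function.Bijective (FreeMonoid.lift (Subtype.val : irreducibles.{u} → MatroidClass.{u})) := by
  constructor
  · intro l l' h
    rw [FreeMonoid.lift_apply, FreeMonoid.lift_apply] at h
    have h1 := eq_of_prod_eq_prod (by simp +contextual) (by simp +contextual) h
    exact FreeMonoid.toList.injective (Subtype.val_injective.list_map h1)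
  · rw [← MonoidHom.mrange_eq_top, FreeMonoid.mrange_lift, Subtype.range_coe]
    exact closure_irreducibles

end MatroidClass

/-- Factorization into irreducibles with respect to free product is unique up to isomorphism, and
the isomorphism classes of matroids form, under free product, a free monoid on the isomorphism
classes of irreducible matroids. -/
theorem mainTheorem1 :
    (∀ (M : FinMatroid.{u}) (k r : ℕ) (Ms : Fin k → FinMatroid.{u}) (Ns : Fin r → FinMatroid.{u}),
      (∀ i, (Ms i).Irreducible) → (∀ j, (Ns j).Irreducible) →
      M.Iso (FinMatroid.freeProductList (List.ofFn Ms)) →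
      M.Iso (FinMatroid.freeProductList (List.ofFn Ns)) →
      ∃ h : k = r, ∀ i : Fin k, (Ms i).Iso (Ns (Fin.cast h i))) ∧
    (∃ e : FreeMonoid MatroidClass.irreducibles.{u} ≃* MatroidClass.{u},
      e 1 = 1 ∧ ∀ c : MatroidClass.irreducibles.{u}, e (FreeMonoid.of c) = c.1) := by
  refine ⟨fun M k r Ms Ns hMs hNs hM hN => ?_,
    MulEquiv.ofBijective _ MatroidClass.bijective_lift_irreducibles, map_one _, fun c => ?_⟩
  · rw [← MatroidClass.mk_eq_mk, MatroidClass.mk_freeProductList, List.map_ofFn] at hM hN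
    have h := MatroidClass.eq_of_prod_eq_prod (l := List.ofFn (MatroidClass.mk ∘ Ms))
      (l' := List.ofFn (MatroidClass.mk ∘ Ns))
      (List.forall_mem_ofFn_iff.2 fun i => ⟨_, hMs i, rfl⟩)
      (List.forall_mem_ofFn_iff.2 fun j => ⟨_, hNs j, rfl⟩) (hM.symm.trans hN)
    obtain rfl : k = r := by simpa using congrArg List.length h
    exact ⟨rfl, fun i => MatroidClass.mk_eq_mk.1 (congrFun (List.ofFn_injective h) i)⟩
  · exact FreeMonoid.lift_eval_of (Subtype.val : MatroidClass.irreducibles → MatroidClass) c
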